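/- Let $d\ge1$ and $K\ge1$ be integers, let $\mathbb M=\{1,\dots,K\}$ and let $\pi$ be a probability measure on $\mathbb M$. For $\xi\in\mathbb R^d$ let $Q_r(\xi)=\xi+[-r/2,r/2]^d$, let $o$ be the origin, let $B_r(\xi)$ be the closed Euclidean ball (empty if $r<0$), and for $A\subset\mathbb R^d$ write $A^{\mathbb M}=A\times\mathbb M$. Let $\mathbb N_{\mathbb M}$ be the family of all locally finite sets $\varphi\subset\mathbb R^d\times\mathbb M$, and let $\mathbb N'\subset\mathbb N_{\mathbb M}$ consist of those $\varphi$ with $\#\varphi\ge K+1$ and $|\xi_1-\xi_2|\ne|\eta_1-\eta_2|$ for all $(\xi_1,k_1),(\xi_2,k_2),(\eta_1,\ell_1),(\eta_2,\ell_2)\in\varphi$ with $\xi_1\ne\xi_2$ and $\{\xi_1,\xi_2\}\ne\{\eta_1,\eta_2\}$. For every $s>1$ let $X^{(1)}=X^{(1)}(s)$ be an independently marked homogeneous Poisson point process in $\mathbb R^d$ with intensity $1-s^{-d-1}$ and mark distribution $\pi$, i.e. a random element of $\mathbb N_{\mathbb M}$ that is a Poisson process with intensity measure $(1-s^{-d-1})\,\mathrm{Leb}\otimes\pi$.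 Define $A_s=A^{(1)}_s\cap A^{(2)}_s\cap A^{(3)}_s\cap A^{(4)}_s$, where: * $A^{(1)}_s$ is the set of all $\varphi\in\mathbb N'$ such that, when $Q_{3s}(o)$ is subdivided into $(3(4d+1))^d$ congruent closed subcubes $Q_{s,i}$ of side length $s/(4d+1)$, $\#(\varphi\cap Q_{s,i}^{\mathbb M})\ge K+1$ for every $i$; * $A^{(2)}_s=\{\varphi\in\mathbb N_{\mathbb M}:\varphi\cap(Q_s(o)\setminus Q_{s-s^{-d}}(o))^{\mathbb M}=\emptyset\}$; * $A^{(3)}_s$ is the set of all $\varphi\in\mathbb N_{\mathbb M}$ such that for every $(\xi,k)\in\varphi\cap Q_{3s}^{\mathbb M}(o)$, with $\rho=\mathrm{dist}(\xi,\partial Q_s(o))$, $\varphi\cap(B_{\rho+s^{-2d}}(\xi)\setminus B_{\rho-s^{-2d}}(\xi))^{\mathbb M}=\emptyset$; * $A^{(4)}_s$ is the set of all $\varphi\in\mathbb N_{\mathbb M}$ such that for all $z,z_1,z_2\in\mathbb Z^d\cap Q_3(o)$ with $|z-z_1|_1=|z-z_2|_1=1$ and $z_1\ne z_2$, and every $(\xi,k)\in\varphi\cap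 Q_s^{\mathbb M}(sz)$, $\big|\mathrm{dist}(\xi,Q_s(sz_1))-\mathrm{dist}(\xi,Q_s(sz_2))\big|\ge s^{-d}$. Then $$\lim_{s\to\infty}\mathbb P\big(X^{(1)}\cap Q_{3s}^{\mathbb M}(o)\in A_s\big)=1 .$$ -/

import Mathlib

open MeasureTheory ProbabilityTheory Filter Topology

noncomputable section

namespace KNNWalk

/-! ### Poisson processes -/

/-- `X` is a Poisson point process (a random set) on the measurable space `S` with intensity
measure `Λ`: counts are random variables, the count of a set of finite intensity is Poisson
distributed, and counts of finitely many pairwise disjoint sets are independent. -/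
structure IsPoissonProcess {Ω S : Type*} [MeasurableSpace Ω] [MeasurableSpace S]
    (P : Measure Ω) (Λ : Measure S) (X : Ω → Set S) : Prop where
  measurable_count : ∀ B : Set S, MeasurableSet B → Measurable fun ω => (X ω ∩ B).encard
  law_count : ∀ B : Set S, MeasurableSet B → Λ B ≠ ⊤ →
    P.map (fun ω => (X ω ∩ B).encard) =
      (poissonMeasure (Λ B).toNNReal).map (Nat.cast : ℕ → ℕ∞)
  indep_count : ∀ (n : ℕ) (B : Fin n → Set S), (∀ i, MeasurableSet (B i)) →
    (Pairwise fun i j => Disjoint (B i) (B j)) →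
    iIndepFun (fun i ω => (X ω ∩ B i).encard) P

/-- Euclidean space `ℝ^d`. -/
abbrev Space (d : ℕ) : Type := EuclideanSpace ℝ (Fin d)

/-- The mark space `{1, …, K}`. -/
abbrev Mark (K : ℕ) : Type := Set.Icc 1 K

/-- A marked configuration: a set of pairs (location, mark). -/
abbrev Config (d K : ℕ) : Type := Set (Space d × Mark K)

/-- The family of marked locally finite sets. -/
def LocFin (d K : ℕ) : Set (Config d K) :=
  {φ | ∀ B : Set (Space d), Bornology.IsBounded B →
    (φ ∩ (B ×ˢ (Set.univ : Set (Mark K)))).Finite}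

/-- `X` is an independently marked homogeneous Poisson point process in `ℝ^d` with intensity `γ`
and mark distribution `π`: a random locally finite marked set that is a Poisson process on
`ℝ^d × {1, …, K}` whose intensity measure is the product of `γ` times Lebesgue measure and `π`. -/
structure IsIndepMarkedPoisson {Ω : Type*} [MeasurableSpace Ω] {d K : ℕ} (P : Measure Ω)
    (γ : ℝ) (π : Measure (Mark K)) (X : Ω → Config d K) : Prop where
  locFin : ∀ ω, X ω ∈ LocFin d K
  poisson : IsPoissonProcess P
    ((ENNReal.ofReal γ • (volume : Measure (Space d))).prod π) X

/-! ### Cubes -/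

/-- The closed cube `Q_s(x)` of side length `s` centred at `x`. -/
def cube {d : ℕ} (s : ℝ) (x : Space d) : Set (Space d) := {ξ | ∀ i, |ξ i - x i| ≤ s / 2}

/-- `A × 𝕄`, for a set `A` of locations. -/
def marked {d : ℕ} (K : ℕ) (A : Set (Space d)) : Config d K := A ×ˢ Set.univ

/-- The point `s z` of `ℝ^d`, for `z ∈ ℤ^d`. -/
def scaled {d : ℕ} (s : ℝ) (z : Fin d → ℤ) : Space d := WithLp.toLp 2 fun i => s * (z i : ℝ)

/-- The subcubes, indexed by `j`, of side length `s / (4 d + 1)` into which `Q_{3s}(o)` is divided;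
there are `(3 (4 d + 1)) ^ d` of them. -/
def subcube {d : ℕ} (s : ℝ) (j : Fin d → Fin (3 * (4 * d + 1))) : Set (Space d) :=
  {ξ | ∀ i, -(3 * s / 2) + ((j i : ℕ) : ℝ) * (s / (4 * d + 1)) ≤ ξ i ∧
    ξ i ≤ -(3 * s / 2) + (((j i : ℕ) : ℝ) + 1) * (s / (4 * d + 1))}

/-! ### The events -/

/-- The family of locally finite marked sets with at least `K + 1` elements and without
coincidences among the distances between pairs of locations. -/
def Admissible (d K : ℕ) : Set (Config d K) :=
  {φ | φ ∈ LocFin d K ∧ ((K + 1 : ℕ) : ℕ∞) ≤ φ.encard ∧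
    ∀ x₁ ∈ φ, ∀ x₂ ∈ φ, ∀ y₁ ∈ φ, ∀ y₂ ∈ φ, x₁.1 ≠ x₂.1 →
      ({x₁.1, x₂.1} : Set (Space d)) ≠ {y₁.1, y₂.1} →
      dist x₁.1 x₂.1 ≠ dist y₁.1 y₂.1}

/-- Every subcube contains at least `K + 1` points. -/
def A1 (d K : ℕ) (s : ℝ) : Set (Config d K) :=
  {φ | φ ∈ Admissible d K ∧ ∀ j : Fin d → Fin (3 * (4 * d + 1)),
    ((K + 1 : ℕ) : ℕ∞) ≤ (φ ∩ marked K (subcube s j)).encard}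

/-- There are no points in `Q_s(o) \ Q_{s - s^{-d}}(o)`. -/
def A2 (d K : ℕ) (s : ℝ) : Set (Config d K) :=
  {φ | φ ∈ LocFin d K ∧
    φ ∩ marked K (cube s 0 \ cube (s - s ^ (-(d : ℤ))) 0) = ∅}

/-- For every point of `φ` in `Q_{3s}(o)`, with location `ξ` at distance `ρ` from `∂Q_s(o)`,
there are no points in `B_{ρ + s^{-2d}}(ξ) \ B_{ρ - s^{-2d}}(ξ)`; balls are closed, and a ball of
negative radius is empty. -/
def A3 (d K : ℕ) (s : ℝ) : Set (Config d K) :=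
  {φ | φ ∈ LocFin d K ∧ ∀ x ∈ φ ∩ marked K (cube (3 * s) 0),
    φ ∩ marked K
      (Metric.closedBall x.1 (Metric.infDist x.1 (frontier (cube s 0)) + s ^ (-(2 * d : ℤ))) \
        Metric.closedBall x.1
          (Metric.infDist x.1 (frontier (cube s 0)) - s ^ (-(2 * d : ℤ)))) = ∅}

/-- The sites of `ℤ^d ∩ Q_3(o)`. -/
def sites (d : ℕ) : Set (Fin d → ℤ) := {z | scaled 1 z ∈ cube 3 (0 : Space d)}

/-- For all sites `z` in `Q_3(o)` and all distinct neighbours `z₁`, `z₂` of `z` in `Q_3(o)`, the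
distances of any point of `φ` in `Q_s(sz)` to `Q_s(s z₁)` and to `Q_s(s z₂)` differ by at
least `s^{-d}`. -/
def A4 (d K : ℕ) (s : ℝ) : Set (Config d K) :=
  {φ | φ ∈ LocFin d K ∧ ∀ z ∈ sites d, ∀ z₁ ∈ sites d, ∀ z₂ ∈ sites d,
    ∑ i, |z i - z₁ i| = 1 → ∑ i, |z i - z₂ i| = 1 → z₁ ≠ z₂ →
    ∀ x ∈ φ ∩ marked K (cube s (scaled s z)),
      s ^ (-(d : ℤ)) ≤ |Metric.infDist x.1 (cube s (scaled s z₁)) -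
        Metric.infDist x.1 (cube s (scaled s z₂))|}

/-- The event `A_s`. -/
def goodEvent (d K : ℕ) (s : ℝ) : Set (Config d K) :=
  A1 d K s ∩ A2 d K s ∩ A3 d K s ∩ A4 d K s

end KNNWalk

end

namespace KNNWalk

/-! ### Tail estimates for the Poisson law -/

open scoped NNReal ENNReal

/-! The proof is a union bound over seven bad events, each of which has vanishing probability. The
number of subcubes depends only on `d`, and each count is Poisson with mean of order `s ^ d`, so all
counts exceed `K` with probability tending to one. Every other bad event says that one location, or
a tuple of distinct locations, lies in a set of configurations of small volume.

Since the intensity is at most one, such probabilities are bounded by volumes. For one location this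
is `1 - exp (-r) ≤ r`. For tuples it is `measure_exists_tuple_le`, obtained from the counts alone:
cut space into cells of mesh `h`. Either two points share a cell, which costs `O(h ^ d)`, or the
points occupy distinct cells whose product comes close to `C`; by independence this costs at most `γ
^ n` times the volume of a thickening of `C`. Let `h → 0`.

The volumes come from Fubini, with one point or one coordinate free. Coincident distances put a
point on a sphere, a null set. The shell and the oblique slabs have thickness of order `s ^ (-d)`
and cross-section `s ^ (d - 1)`, hence volume `O(1 / s)`. Pairs violating the annulus condition have
volume of order `s ^ (-2d) * s ^ (d - 1) * s ^ d = 1 / s`, which explains the exponent `2d`. What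
remains is deterministic: a configuration avoiding all bad events is good. -/

lemma poissonMeasure_one_le (r : ℝ≥0) : poissonMeasure r {n | 1 ≤ n} ≤ r := by
  have h : ({n | 1 ≤ n} : Set ℕ) = {0}ᶜ := by
    ext n; simp [Nat.one_le_iff_ne_zero]
  rw [h, prob_compl_eq_one_sub (measurableSet_singleton 0), poissonMeasure_singleton,
    tsub_le_iff_right, ← ENNReal.ofReal_coe_nnreal, ← ENNReal.ofReal_add (by positivity)
      (by positivity)]
  rw [← ENNReal.ofReal_one]
  apply ENNReal.ofReal_le_ofReal
  have := Real.add_one_le_exp (-(r : ℝ))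
  simp only [pow_zero, Nat.factorial_zero, Nat.cast_one]
  linarith

/-- From `exp (-r) ≥ 1 - r` one gets `(1 + r) * exp (-r) ≥ 1 - r ^ 2`. The quadratic order is what
makes collisions in a cell negligible after summing over cells. -/
lemma poissonMeasure_two_le (r : ℝ≥0) : poissonMeasure r {n | 2 ≤ n} ≤ (r : ℝ≥0∞) ^ 2 := by
  have h : ({n | 2 ≤ n} : Set ℕ) = ({0} ∪ {1} : Set ℕ)ᶜ := by
    ext n; simp; omega
  rw [h, prob_compl_eq_one_sub (by measurability),
    measure_union (by simp) (measurableSet_singleton 1), poissonMeasure_singleton,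
    poissonMeasure_singleton, tsub_le_iff_right, ← ENNReal.ofReal_coe_nnreal,
    ← ENNReal.ofReal_pow (by positivity), ← ENNReal.ofReal_add (by positivity) (by positivity),
    ← ENNReal.ofReal_add (by positivity) (by positivity), ← ENNReal.ofReal_one]
  apply ENNReal.ofReal_le_ofReal
  have := Real.add_one_le_exp (-(r : ℝ))
  have hr : (0 : ℝ) ≤ r := r.2
  simp only [pow_zero, Nat.factorial_zero, Nat.cast_one, pow_one, Nat.factorial_one]
  nlinarith

lemma tendsto_poissonMeasure_le (K : ℕ) :
    Tendsto (fun r : ℝ≥0 => poissonMeasure r {n | n ≤ K}) atTop (𝓝 0) := by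
  have h : ∀ r : ℝ≥0, poissonMeasure r {n | n ≤ K} =
      ∑ n ∈ Finset.range (K + 1), ENNReal.ofReal (Real.exp (-r) * r ^ n / n.factorial) := by
    intro r
    have : ({n | n ≤ K} : Set ℕ) = Finset.range (K + 1) := by ext n; simp
    rw [this, ← sum_measure_singleton]
    simp_rw [poissonMeasure_singleton]
  simp_rw [h]
  rw [show (0 : ℝ≥0∞) = ∑ n ∈ Finset.range (K + 1), ENNReal.ofReal 0 by simp]
  refine tendsto_finsetSum _ fun n _ => ENNReal.tendsto_ofReal ?_
  have := (Real.tendsto_pow_mul_exp_neg_atTop_nhds_zero n).comp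
    (NNReal.tendsto_coe_atTop.2 tendsto_id)
  have := this.div_const (n.factorial : ℝ)
  rw [zero_div] at this
  refine this.congr fun r => ?_
  simp [mul_comm]

/-! ### From laws of counts to volume bounds -/

section Counts

variable {Ω : Type*} [MeasurableSpace Ω] {d K : ℕ} {P : Measure Ω} {γ : ℝ}
  {π : Measure (Mark K)} {X : Ω → Config d K}

lemma measurableSet_marked {B : Set (Space d)} (hB : MeasurableSet B) :
    MeasurableSet (marked K B) :=
  hB.prod MeasurableSet.univ

lemma intensity_marked [IsProbabilityMeasure π] (B : Set (Space d)) :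
    ((ENNReal.ofReal γ • (volume : Measure (Space d))).prod π) (marked K B) =
      ENNReal.ofReal γ * volume B := by
  simp [marked, Measure.prod_prod]

namespace IsIndepMarkedPoisson

lemma measure_count_mem [IsProbabilityMeasure π] (hX : IsIndepMarkedPoisson P γ π X)
    {B : Set (Space d)} (hB : MeasurableSet B) (hB' : volume B ≠ ⊤) (T : Set ℕ∞) :
    P {ω | (X ω ∩ marked K B).encard ∈ T} =
      poissonMeasure (ENNReal.ofReal γ * volume B).toNNReal {n | (n : ℕ∞) ∈ T} := by
  have hm := measurableSet_marked (K := K) hB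
  have h := hX.poisson.law_count _ hm
    (by rw [intensity_marked]; exact ENNReal.mul_ne_top ENNReal.ofReal_ne_top hB')
  have h2 := congrArg (fun μ : Measure ℕ∞ => μ T) h
  rw [Measure.map_apply (hX.poisson.measurable_count _ hm) trivial,
    Measure.map_apply .of_discrete (.of_discrete (s := T)), intensity_marked] at h2
  exact h2

lemma measure_nonempty_le [IsProbabilityMeasure π] (hX : IsIndepMarkedPoisson P γ π X)
    {B : Set (Space d)} (hB : MeasurableSet B) (hB' : volume B ≠ ⊤) :
    P {ω | 1 ≤ (X ω ∩ marked K B).encard} ≤ ENNReal.ofReal γ * volume B := by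
  have := hX.measure_count_mem hB hB' {n | 1 ≤ n}
  simp only [Set.mem_ofPred_eq, Nat.one_le_cast] at this
  rw [this]
  refine (poissonMeasure_one_le _).trans ENNReal.coe_toNNReal_le_self

lemma measure_two_le_le [IsProbabilityMeasure π] (hX : IsIndepMarkedPoisson P γ π X)
    {B : Set (Space d)} (hB : MeasurableSet B) (hB' : volume B ≠ ⊤) :
    P {ω | 2 ≤ (X ω ∩ marked K B).encard} ≤ (ENNReal.ofReal γ * volume B) ^ 2 := by
  have := hX.measure_count_mem hB hB' {n | 2 ≤ n}
  simp only [Set.mem_ofPred_eq, Nat.ofNat_le_cast] at this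
  rw [this]
  refine (poissonMeasure_two_le _).trans ?_
  gcongr
  exact ENNReal.coe_toNNReal_le_self

/-- Independence over disjoint sets turns the probability into a product of one-point bounds, which
is the volume of the product set up to `γ ^ n`. -/
lemma measure_forall_nonempty_le [IsProbabilityMeasure π] [IsProbabilityMeasure P]
    (hX : IsIndepMarkedPoisson P γ π X)
    {n : ℕ} {B : Fin n → Set (Space d)} (hB : ∀ i, MeasurableSet (B i))
    (hB' : ∀ i, volume (B i) ≠ ⊤) (hd : Pairwise fun i j => Disjoint (B i) (B j)) :
    P {ω | ∀ i, 1 ≤ (X ω ∩ marked K (B i)).encard} ≤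
      ENNReal.ofReal γ ^ n * (volume : Measure (Fin n → Space d)) (Set.univ.pi B) := by
  have hi := hX.poisson.indep_count n (fun i => marked K (B i))
    (fun i => measurableSet_marked (hB i))
    (fun i j hij => Set.disjoint_prod.2 (Or.inl (hd hij)))
  have h := hi.meas_iInter (s := fun i => {ω | 1 ≤ (X ω ∩ marked K (B i)).encard})
    (fun i => ⟨{n | 1 ≤ n}, trivial, rfl⟩)
  rw [Set.ofPred_forall, h, volume_pi_pi]
  calc _ ≤ ∏ i, (ENNReal.ofReal γ * volume (B i)) :=
        Finset.prod_le_prod' fun i _ => hX.measure_nonempty_le (hB i) (hB' i)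
    _ = _ := by simp [Finset.prod_mul_distrib]

end IsIndepMarkedPoisson

end Counts

/-! ### Partition of space into half-open cells -/

section Grid

variable {d : ℕ}

/-- The index of the cell of mesh `h` that contains `ξ`. -/
noncomputable def gridIndex (h : ℝ) (ξ : Space d) : Fin d → ℤ := fun i => ⌊ξ i / h⌋

/-- The half-open cell of mesh `h` with index `k`. -/
def gridCell (h : ℝ) (k : Fin d → ℤ) : Set (Space d) := gridIndex h ⁻¹' {k}

lemma measurableSet_gridCell (h : ℝ) (k : Fin d → ℤ) : MeasurableSet (gridCell h k) := by
  have : Measurable (gridIndex h : Space d → Fin d → ℤ) := by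
    refine measurable_pi_iff.2 fun i => Int.measurable_floor.comp ?_
    fun_prop
  exact this (measurableSet_singleton k)

lemma disjoint_gridCell (h : ℝ) {k l : Fin d → ℤ} (hkl : k ≠ l) :
    Disjoint (gridCell h k) (gridCell h l) :=
  Disjoint.preimage _ (by simpa using hkl)

lemma volume_gridCell {h : ℝ} (hh : 0 < h) (k : Fin d → ℤ) :
    volume (gridCell h k) = ENNReal.ofReal h ^ d := by
  have : gridCell h k = WithLp.ofLp ⁻¹'
      (Set.univ.pi fun i => Set.Ico ((k i : ℝ) * h) ((k i : ℝ) * h + h)) := by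
    ext ξ
    simp only [gridCell, gridIndex, Set.mem_preimage, Set.mem_singleton_iff, Set.mem_pi,
      Set.mem_univ, forall_true_left, funext_iff, Int.floor_eq_iff, Set.mem_Ico]
    refine forall_congr' fun i => ?_
    rw [le_div_iff₀ hh, div_lt_iff₀ hh, add_mul, one_mul]
  rw [this, (PiLp.volume_preserving_ofLp (Fin d)).measure_preimage
    (MeasurableSet.univ_pi fun i => measurableSet_Ico).nullMeasurableSet, volume_pi_pi]
  simp

lemma abs_sub_le_of_gridIndex_eq {h : ℝ} (hh : 0 < h) {ξ η : Space d}
    (he : gridIndex h ξ = gridIndex h η) (i : Fin d) : |ξ i - η i| ≤ h := by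
  have := Int.abs_sub_lt_one_of_floor_eq_floor (congrFun he i)
  rw [← sub_div, abs_div, abs_of_pos hh, div_lt_one hh] at this
  exact this.le

lemma dist_le_of_forall_abs_sub_le {ξ η : Space d} {r : ℝ} (hr : 0 ≤ r)
    (h : ∀ i, |ξ i - η i| ≤ r) : dist ξ η ≤ d * r := by
  rw [EuclideanSpace.dist_eq, Real.sqrt_le_left (by positivity)]
  calc ∑ i, dist (ξ i) (η i) ^ 2 ≤ ∑ _i : Fin d, r ^ 2 := by
        gcongr with i
        exact h i
    _ = d * r ^ 2 := by simp
    _ ≤ (d * r) ^ 2 := by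
        rw [mul_pow]
        gcongr
        exact_mod_cast Nat.le_self_pow two_ne_zero d

lemma dist_le_of_gridIndex_eq {h : ℝ} (hh : 0 < h) {ξ η : Space d}
    (he : gridIndex h ξ = gridIndex h η) : dist ξ η ≤ d * h :=
  dist_le_of_forall_abs_sub_le hh.le (abs_sub_le_of_gridIndex_eq hh he)

lemma finite_gridIndex_image {h : ℝ} (hh : 0 < h) (R : ℝ) :
    (gridIndex h '' Metric.closedBall (0 : Space d) R).Finite := by
  refine (Set.Finite.pi' fun _ : Fin d => Set.finite_Icc ⌊-R / h⌋ ⌊R / h⌋).subset ?_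
  rintro _ ⟨ξ, hξ, rfl⟩ i
  have hi : |ξ i| ≤ R := by
    have := PiLp.norm_apply_le ξ i
    rw [Real.norm_eq_abs] at this
    exact this.trans (by simpa using hξ)
  rw [abs_le] at hi
  exact ⟨Int.floor_le_floor (by gcongr; exact hi.1), Int.floor_le_floor (by gcongr; exact hi.2)⟩

lemma iUnion_gridCell_subset_cthickening {h : ℝ} (hh : 0 < h) (R : ℝ) :
    ⋃ k ∈ (finite_gridIndex_image hh R).toFinset, gridCell h k ⊆
      Metric.cthickening (d * h) (Metric.closedBall (0 : Space d) R) := by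
  intro η hη
  simp only [Set.mem_iUnion, Set.Finite.mem_toFinset] at hη
  obtain ⟨_, ⟨ξ, hξ, rfl⟩, hk⟩ := hη
  exact Metric.mem_cthickening_of_dist_le _ ξ _ _ hξ (dist_le_of_gridIndex_eq hh hk)

end Grid

/-! ### First-moment bound for tuples, by discretisation -/

section Tuples

variable {Ω : Type*} [MeasurableSpace Ω] {d K : ℕ} {P : Measure Ω} {γ : ℝ}
  {π : Measure (Mark K)} {X : Ω → Config d K}

lemma one_le_encard_inter_marked {φ : Config d K} {B : Set (Space d)} {x : Space d × Mark K}
    (hx : x ∈ φ) (hB : x.1 ∈ B) : 1 ≤ (φ ∩ marked K B).encard :=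
  Set.one_le_encard_iff_nonempty.2 ⟨x, hx, hB, trivial⟩

namespace IsIndepMarkedPoisson

/-- Each cell contributes `(γ * h ^ d) ^ 2`. One factor `h ^ d` is kept and the other is summed to
the volume of the union of the cells, which stays bounded as `h → 0`. -/
lemma measure_collision_le [IsProbabilityMeasure π]
    (hX : IsIndepMarkedPoisson P γ π X) {h : ℝ} (hh : 0 < h) (R : ℝ) :
    P (⋃ k ∈ (finite_gridIndex_image (d := d) hh R).toFinset,
        {ω | 2 ≤ (X ω ∩ marked K (gridCell h k)).encard}) ≤
      ENNReal.ofReal γ ^ 2 * ENNReal.ofReal h ^ d *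
        volume (Metric.cthickening (d * h) (Metric.closedBall (0 : Space d) R)) := by
  set I := (finite_gridIndex_image (d := d) hh R).toFinset
  have hfin : ∀ k : Fin d → ℤ, volume (gridCell h k) ≠ ⊤ := fun k => by
    rw [volume_gridCell hh]; simp
  calc _ ≤ ∑ k ∈ I, P {ω | 2 ≤ (X ω ∩ marked K (gridCell h k)).encard} :=
        measure_biUnion_finset_le _ _
    _ ≤ ∑ k ∈ I, ENNReal.ofReal γ ^ 2 * ENNReal.ofReal h ^ d * volume (gridCell h k) := by
        gcongr with k
        refine (hX.measure_two_le_le (measurableSet_gridCell h k) (hfin k)).trans_eq ?_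
        rw [volume_gridCell hh]
        ring
    _ = ENNReal.ofReal γ ^ 2 * ENNReal.ofReal h ^ d * volume (⋃ k ∈ I, gridCell h k) := by
        rw [measure_biUnion_finset (fun k _ l _ hkl => disjoint_gridCell h hkl)
          (fun k _ => measurableSet_gridCell h k), Finset.mul_sum]
    _ ≤ _ := by
        gcongr
        exact iUnion_gridCell_subset_cthickening hh R

/-- Injectivity of `κ` makes the cells disjoint, so the counts are independent. Products of cells
with different `κ` are disjoint too, so their volumes add up without overcounting to that of a set
near `C`. -/
lemma measure_exists_cells_le [IsProbabilityMeasure π] [IsProbabilityMeasure P]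
    (hX : IsIndepMarkedPoisson P γ π X) {n : ℕ} (C : Set (Fin n → Space d))
    {h : ℝ} (hh : 0 < h) (J : Finset (Fin n → Fin d → ℤ))
    (hJ : ∀ κ ∈ J, Function.Injective κ ∧ ∃ x ∈ C, ∀ i, gridIndex h (x i) = κ i) :
    P (⋃ κ ∈ J, {ω | ∀ i, 1 ≤ (X ω ∩ marked K (gridCell h (κ i))).encard}) ≤
      ENNReal.ofReal γ ^ n *
        (volume : Measure (Fin n → Space d)) (Metric.cthickening (d * h) C) := by
  calc _ ≤ ∑ κ ∈ J, P {ω | ∀ i, 1 ≤ (X ω ∩ marked K (gridCell h (κ i))).encard} :=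
        measure_biUnion_finset_le _ _
    _ ≤ ∑ κ ∈ J, ENNReal.ofReal γ ^ n *
          (volume : Measure (Fin n → Space d)) (Set.univ.pi fun i => gridCell h (κ i)) := by
        gcongr with κ hκ
        exact hX.measure_forall_nonempty_le (fun i => measurableSet_gridCell h _)
          (fun i => by rw [volume_gridCell hh]; simp)
          (fun i j hij => disjoint_gridCell h ((hJ κ hκ).1.ne hij))
    _ = ENNReal.ofReal γ ^ n * (volume : Measure (Fin n → Space d))
          (⋃ κ ∈ J, Set.univ.pi fun i => gridCell h (κ i)) := by
        rw [measure_biUnion_finset _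
          (fun k _ => MeasurableSet.univ_pi fun i => measurableSet_gridCell h _), Finset.mul_sum]
        intro κ _ l _ hkl
        obtain ⟨i, hi⟩ := Function.ne_iff.1 hkl
        exact Set.disjoint_univ_pi.2 ⟨i, disjoint_gridCell h hi⟩
    _ ≤ _ := by
        gcongr
        intro y hy
        simp only [Set.mem_iUnion, Set.mem_pi, Set.mem_univ, forall_true_left] at hy
        obtain ⟨κ, hκ, hy⟩ := hy
        obtain ⟨x, hx, hxκ⟩ := (hJ κ hκ).2
        refine Metric.mem_cthickening_of_dist_le _ x _ _ hx ?_
        rw [dist_pi_le_iff (by positivity)]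
        exact fun i => dist_le_of_gridIndex_eq hh ((hy i).trans (hxκ i).symm)

/-- The probability that `n` distinct locations of the process form an element of a compact set
`C` is at most the `n`-th power of the intensity times the volume of `C`. -/
theorem measure_exists_tuple_le [IsProbabilityMeasure π] [IsProbabilityMeasure P]
    (hX : IsIndepMarkedPoisson P γ π X) {n : ℕ} {C : Set (Fin n → Space d)} (hC : IsCompact C)
    (hd : 1 ≤ d) :
    P {ω | ∃ x ∈ C, Function.Injective x ∧ ∀ i, ∃ k, (x i, k) ∈ X ω} ≤
      ENNReal.ofReal γ ^ n * (volume : Measure (Fin n → Space d)) C := by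
  classical
  obtain ⟨R, hR⟩ := hC.isBounded.subset_closedBall 0
  have hbound : ∀ h : ℝ, 0 < h →
      P {ω | ∃ x ∈ C, Function.Injective x ∧ ∀ i, ∃ k, (x i, k) ∈ X ω} ≤
        ENNReal.ofReal γ ^ 2 * ENNReal.ofReal h ^ d *
          volume (Metric.cthickening (d * h) (Metric.closedBall (0 : Space d) R)) +
        ENNReal.ofReal γ ^ n *
          (volume : Measure (Fin n → Space d)) (Metric.cthickening (d * h) C) := by
    intro h hh
    set I := (finite_gridIndex_image (d := d) hh R).toFinset with hI
    set J := {κ ∈ Fintype.piFinset fun _ : Fin n => I |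
      Function.Injective κ ∧ ∃ x ∈ C, ∀ i, gridIndex h (x i) = κ i} with hJ
    refine (measure_mono ?_).trans ((measure_union_le _ _).trans
      (add_le_add (hX.measure_collision_le hh R)
        (hX.measure_exists_cells_le C hh J fun κ hκ => (Finset.mem_filter.1 hκ).2)))
    rintro ω ⟨x, hxC, hinj, hx⟩
    have hxI : ∀ i, gridIndex h (x i) ∈ I := by
      intro i
      rw [hI, Set.Finite.mem_toFinset]
      refine ⟨x i, ?_, rfl⟩
      have := hR hxC
      rw [mem_closedBall_zero_iff] at this ⊢
      exact (norm_le_pi_norm x i).trans this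
    -- Either the points lie in pairwise different cells, or two different locations share one.
    by_cases hκ : Function.Injective fun i => gridIndex h (x i)
    · right
      simp only [Set.mem_iUnion]
      refine ⟨fun i => gridIndex h (x i), ?_, fun i => ?_⟩
      · rw [hJ, Finset.mem_filter, Fintype.mem_piFinset]
        exact ⟨hxI, hκ, x, hxC, fun i => rfl⟩
      · obtain ⟨k, hk⟩ := hx i
        exact one_le_encard_inter_marked hk rfl
    · left
      simp only [Function.Injective, not_forall] at hκ
      obtain ⟨i, j, hij, hne⟩ := hκ
      simp only [Set.mem_iUnion]
      refine ⟨gridIndex h (x i), hxI i, ?_⟩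
      obtain ⟨k, hk⟩ := hx i
      obtain ⟨l, hl⟩ := hx j
      rw [Set.mem_ofPred_eq]
      rw [← one_add_one_eq_two, ENat.add_one_le_iff (by simp), Set.one_lt_encard_iff]
      exact ⟨_, _, ⟨hk, rfl, trivial⟩, ⟨hl, hij.symm, trivial⟩,
        fun he => hne (hinj (congrArg Prod.fst he))⟩
  have hmul : Tendsto (fun h : ℝ => d * h) (𝓝[>] 0) (𝓝 0) := by
    have : Tendsto (fun h : ℝ => d * h) (𝓝 0) (𝓝 (d * 0)) := tendsto_id.const_mul _
    rw [mul_zero] at this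
    exact this.mono_left nhdsWithin_le_nhds
  have hpow : Tendsto (fun h : ℝ => ENNReal.ofReal γ ^ 2 * ENNReal.ofReal h ^ d)
      (𝓝[>] 0) (𝓝 0) := by
    have h1 : Tendsto (fun h : ℝ => ENNReal.ofReal h ^ d) (𝓝 0) (𝓝 (ENNReal.ofReal 0 ^ d)) :=
      (ENNReal.continuous_pow d).continuousAt.tendsto.comp
        (ENNReal.continuous_ofReal.tendsto 0)
    have h2 := ENNReal.Tendsto.const_mul (a := ENNReal.ofReal γ ^ 2) h1 (Or.inr (by simp))
    -- `1 ≤ d` is needed here: otherwise the collision term would not vanish.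
    rw [ENNReal.ofReal_zero, zero_pow (by omega), mul_zero] at h2
    exact h2.mono_left nhdsWithin_le_nhds
  have hball : Tendsto (fun h : ℝ =>
      volume (Metric.cthickening (d * h) (Metric.closedBall (0 : Space d) R)))
      (𝓝[>] 0) (𝓝 (volume (Metric.closedBall (0 : Space d) R))) :=
    (tendsto_measure_cthickening_of_isCompact (isCompact_closedBall _ _)).comp hmul
  have hlim := (ENNReal.Tendsto.mul hpow (Or.inr measure_closedBall_lt_top.ne) hball
    (Or.inr ENNReal.zero_ne_top)).add (ENNReal.Tendsto.const_mul (a := ENNReal.ofReal γ ^ n)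
      -- Compactness of `C` lets the volumes of its thickenings decrease to that of `C` itself.
      ((tendsto_measure_cthickening_of_isCompact (μ := volume) hC).comp hmul)
      (Or.inr (by simp)))
  rw [zero_mul, zero_add] at hlim
  exact ge_of_tendsto hlim (eventually_mem_nhdsWithin.mono fun h hh => hbound h hh)

end IsIndepMarkedPoisson

end Tuples

/-- Fubini with coordinate `i` innermost. A slice is either empty or passes through a point of `A`,
so it suffices to bound slices through points of `A`; the other coordinates range over a product of
measure at most `b ^ n`. -/
lemma measure_pi_le_of_slice_le {α : Type*} [MeasurableSpace α] (μ : Measure α) [SigmaFinite μ]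
    {n : ℕ} (i : Fin (n + 1)) {A : Set (Fin (n + 1) → α)} (hA : MeasurableSet A)
    {B : Fin (n + 1) → Set α} {b c : ℝ≥0∞} (hAB : A ⊆ Set.univ.pi B)
    (hB : ∀ j, MeasurableSet (B j)) (hb : ∀ j, μ (B j) ≤ b)
    (hc : ∀ x ∈ A, μ {t | Function.update x i t ∈ A} ≤ c) :
    Measure.pi (fun _ => μ) A ≤ c * b ^ n := by
  set e := MeasurableEquiv.piFinSuccAbove (fun _ : Fin (n + 1) => α) i
  have he : MeasurePreserving e.symm (μ.prod (Measure.pi fun _ : Fin n => μ))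
      (Measure.pi fun _ => μ) := (measurePreserving_piFinSuccAbove (fun _ => μ) i).symm
  have hesymm : ∀ t y, e.symm (t, y) = i.insertNth t y := fun t y => rfl
  set D : Set (Fin n → α) := Set.univ.pi fun j => B (i.succAbove j)
  have hD : MeasurableSet D := MeasurableSet.univ_pi fun j => hB _
  rw [← he.measure_preimage hA.nullMeasurableSet, Measure.prod_apply_symm (e.symm.measurable hA)]
  calc _ ≤ ∫⁻ y, D.indicator (fun _ => c) y ∂(Measure.pi fun _ : Fin n => μ) := by
        refine lintegral_mono fun y => ?_
        rcases Set.eq_empty_or_nonempty ((fun t => (t, y)) ⁻¹' (e.symm ⁻¹' A)) with h | ⟨t₀, ht₀⟩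
        · simp [h]
        · have hx : i.insertNth t₀ y ∈ A := ht₀
          have hy : y ∈ D := fun j _ => by
            have := hAB hx (i.succAbove j) trivial
            rwa [Fin.insertNth_apply_succAbove] at this
          rw [Set.indicator_of_mem hy]
          refine le_trans (measure_mono fun t ht => ?_) (hc _ hx)
          rw [Set.mem_ofPred_eq, Fin.update_insertNth]
          exact ht
    _ = c * ∏ j, μ (B (i.succAbove j)) := by
        rw [lintegral_indicator hD, setLIntegral_const, Measure.pi_pi]
    _ ≤ c * ∏ _j : Fin n, b := by
        gcongr with j
        exact hb _
    _ = c * b ^ n := by simp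

/-! ### Geometry and volumes of cubes, slabs and annuli -/

section Cubes

variable {d : ℕ}

lemma cube_eq_preimage (s : ℝ) (x : Space d) :
    cube s x = WithLp.ofLp ⁻¹' (Set.univ.pi fun i => Set.Icc (x i - s / 2) (x i + s / 2)) := by
  ext ξ
  simp only [cube, Set.mem_ofPred_eq, abs_le, Set.mem_preimage, Set.mem_pi, Set.mem_univ,
    forall_true_left, Set.mem_Icc]
  refine forall_congr' fun i => and_congr ⟨fun h => ?_, fun h => ?_⟩ ⟨fun h => ?_, fun h => ?_⟩ <;>
    linarith

lemma isClosed_cube (s : ℝ) (x : Space d) : IsClosed (cube s x) := by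
  rw [cube, Set.ofPred_forall]
  refine isClosed_iInter fun i => isClosed_le ?_ continuous_const
  fun_prop

lemma dist_le_of_mem_cube {s : ℝ} (hs : 0 ≤ s) {x ξ : Space d} (h : ξ ∈ cube s x) :
    dist ξ x ≤ d * (s / 2) :=
  dist_le_of_forall_abs_sub_le (by positivity) h

lemma isCompact_cube {s : ℝ} (hs : 0 ≤ s) (x : Space d) : IsCompact (cube s x) :=
  Metric.isCompact_of_isClosed_isBounded (isClosed_cube s x)
    (Metric.isBounded_closedBall.subset fun _ h => dist_le_of_mem_cube hs h)

lemma mem_cube_self {s : ℝ} (hs : 0 ≤ s) (x : Space d) : x ∈ cube s x := fun i => by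
  simpa using by positivity

lemma cube_mono {s t : ℝ} (h : s ≤ t) (x : Space d) : cube s x ⊆ cube t x :=
  fun _ hξ i => (hξ i).trans (by linarith)

lemma volume_cube (s : ℝ) (x : Space d) : volume (cube s x) = ENNReal.ofReal s ^ d := by
  rw [cube_eq_preimage, (PiLp.volume_preserving_ofLp (Fin d)).measure_preimage
    (MeasurableSet.univ_pi fun i => measurableSet_Icc).nullMeasurableSet, volume_pi_pi]
  simp [add_sub_sub_cancel]

lemma subcube_eq_preimage (s : ℝ) (j : Fin d → Fin (3 * (4 * d + 1))) :
    subcube s j = WithLp.ofLp ⁻¹' (Set.univ.pi fun i =>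
      Set.Icc (-(3 * s / 2) + ((j i : ℕ) : ℝ) * (s / (4 * d + 1)))
        (-(3 * s / 2) + (((j i : ℕ) : ℝ) + 1) * (s / (4 * d + 1)))) := by
  ext ξ
  simp only [subcube, Set.mem_ofPred_eq, Set.mem_preimage, Set.mem_pi, Set.mem_univ,
    forall_true_left, Set.mem_Icc]

lemma measurableSet_subcube (s : ℝ) (j : Fin d → Fin (3 * (4 * d + 1))) :
    MeasurableSet (subcube s j) := by
  rw [subcube_eq_preimage]
  exact (PiLp.volume_preserving_ofLp (Fin d)).measurable
    (MeasurableSet.univ_pi fun i => measurableSet_Icc)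

lemma volume_subcube (s : ℝ) (j : Fin d → Fin (3 * (4 * d + 1))) :
    volume (subcube s j) = ENNReal.ofReal (s / (4 * d + 1)) ^ d := by
  rw [subcube_eq_preimage, (PiLp.volume_preserving_ofLp (Fin d)).measure_preimage
    (MeasurableSet.univ_pi fun i => measurableSet_Icc).nullMeasurableSet, volume_pi_pi]
  simp only [Real.volume_Icc]
  simp [add_mul]

lemma subcube_subset {s : ℝ} (hs : 0 ≤ s) (j : Fin d → Fin (3 * (4 * d + 1))) :
    subcube s j ⊆ cube (3 * s) 0 := by
  intro ξ hξ i
  obtain ⟨h1, h2⟩ := hξ i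
  have hj : ((j i : ℕ) : ℝ) + 1 ≤ 3 * (4 * d + 1) := by exact_mod_cast (j i).2
  have hw : 0 ≤ s / (4 * d + 1) := by positivity
  have h3 : (((j i : ℕ) : ℝ) + 1) * (s / (4 * d + 1)) ≤ 3 * s := by
    calc _ ≤ 3 * (4 * (d : ℝ) + 1) * (s / (4 * d + 1)) := by gcongr
      _ = 3 * s := by field_simp
  have h4 : 0 ≤ ((j i : ℕ) : ℝ) * (s / (4 * d + 1)) := by positivity
  simp only [PiLp.zero_apply, sub_zero, abs_le]
  constructor <;> linarith

lemma volume_le_of_slice_le (i : Fin d) {A : Set (Space d)} (hA : MeasurableSet A) {r : ℝ}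
    {x : Space d} (hAx : A ⊆ cube r x) {c : ℝ≥0∞}
    (hc : ∀ ξ ∈ A, volume {t : ℝ | WithLp.toLp 2 (Function.update ξ.ofLp i t) ∈ A} ≤ c) :
    volume A ≤ c * ENNReal.ofReal r ^ (d - 1) := by
  obtain _ | n := d
  · exact i.elim0
  rw [← (PiLp.volume_preserving_toLp (Fin (n + 1))).measure_preimage hA.nullMeasurableSet]
  refine measure_pi_le_of_slice_le volume i
    ((PiLp.volume_preserving_toLp (Fin (n + 1))).measurable hA)
    (B := fun i => Set.Icc (x i - r / 2) (x i + r / 2)) ?_ (fun _ => measurableSet_Icc)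
    (fun j => by simp [add_sub_sub_cancel]) (fun y hy => hc _ hy)
  intro y hy
  have := hAx hy
  rwa [cube_eq_preimage] at this

lemma volume_slab_le (i : Fin d) (r : ℝ) (x : Space d) {T : Set ℝ} (hT : MeasurableSet T) :
    volume {ξ ∈ cube r x | ξ i ∈ T} ≤ volume T * ENNReal.ofReal r ^ (d - 1) := by
  have hm : Measurable fun ξ : Space d => ξ i := by fun_prop
  refine volume_le_of_slice_le i ((isClosed_cube r x).measurableSet.inter (hm hT))
    (fun ξ hξ => hξ.1) fun ξ _ => measure_mono fun t ht => ?_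
  simpa using ht.2

/-- Slice along coordinate `i`. If `i ≠ j`, the free coordinate is confined to an interval of radius
`ε`; if `i = j`, the signs are opposite, the coefficient is `±2`, and the interval is shorter still.
-/
lemma volume_oblique_slab_le {s ε : ℝ} (x : Space d) {i j : Fin d} {σ τ : ℝ}
    (hσ : σ = 1 ∨ σ = -1) (hτ : τ = 1 ∨ τ = -1) (h : i = j → σ ≠ τ) :
    volume {ξ ∈ cube s x | |σ * (ξ i - x i) - τ * (ξ j - x j)| < ε} ≤
      ENNReal.ofReal (2 * ε) * ENNReal.ofReal s ^ (d - 1) := by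
  have hσσ : σ * σ = 1 := by rcases hσ with rfl | rfl <;> norm_num
  have hm : Measurable fun ξ : Space d => |σ * (ξ i - x i) - τ * (ξ j - x j)| := by fun_prop
  refine volume_le_of_slice_le i ((isClosed_cube s x).measurableSet.inter
    (measurableSet_lt hm measurable_const)) (fun ξ hξ => hξ.1) fun ξ _ => ?_
  by_cases hij : i = j
  · subst hij
    rw [← Real.volume_ball (x i) ε]
    refine measure_mono fun t ht => ?_
    have ht2 := ht.2
    simp only [Set.mem_ofPred_eq, Function.update_self] at ht2
    rw [Metric.mem_ball, Real.dist_eq]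
    have h2 : |σ - τ| = 2 := by
      have := h rfl
      rcases hσ with rfl | rfl <;> rcases hτ with rfl | rfl <;> norm_num at *
    rw [← sub_mul, abs_mul, h2] at ht2
    have := abs_nonneg (t - x i)
    linarith
  · rw [← Real.volume_ball (x i + σ * (τ * (ξ j - x j))) ε]
    refine measure_mono fun t ht => ?_
    have ht2 := ht.2
    simp only [Set.mem_ofPred_eq, Function.update_self,
      Function.update_of_ne (Ne.symm hij)] at ht2
    rw [Metric.mem_ball, Real.dist_eq]
    have habs : |σ| = 1 := by rcases hσ with rfl | rfl <;> norm_num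
    calc |t - (x i + σ * (τ * (ξ j - x j)))|
        = |σ| * |t - (x i + σ * (τ * (ξ j - x j)))| := by rw [habs, one_mul]
      _ = |σ * (t - x i) - τ * (ξ j - x j)| := by
          rw [← abs_mul]; congr 1
          linear_combination -(τ * (ξ j - x j)) * hσσ
      _ < ε := ht2

lemma volume_cube_diff_cube_le {s ε : ℝ} :
    volume (cube s (0 : Space d) \ cube (s - ε) 0) ≤
      d * (ENNReal.ofReal ε * ENNReal.ofReal s ^ (d - 1)) := by
  -- A point of the shell has some coordinate in `T`: two end intervals of length `ε / 2` each, both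
  -- empty when `ε < 0`.
  set T : Set ℝ := Set.Icc (-(s / 2)) (-((s - ε) / 2)) ∪ Set.Icc ((s - ε) / 2) (s / 2) with hT
  have hTm : MeasurableSet T := measurableSet_Icc.union measurableSet_Icc
  have hTv : volume T ≤ ENNReal.ofReal ε := by
    refine (measure_union_le _ _).trans ?_
    rw [Real.volume_Icc, Real.volume_Icc]
    rcases le_total 0 ε with h | h
    · rw [← ENNReal.ofReal_add (by linarith) (by linarith)]
      exact ENNReal.ofReal_le_ofReal (by linarith)
    · rw [ENNReal.ofReal_of_nonpos (by linarith), ENNReal.ofReal_of_nonpos (by linarith)]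
      simp
  calc _ ≤ volume (⋃ i, {ξ ∈ cube s (0 : Space d) | ξ i ∈ T}) := by
        refine measure_mono fun ξ hξ => ?_
        have h2 : ∃ i, (s - ε) / 2 < |ξ i| := by simpa [cube] using hξ.2
        obtain ⟨i, hi⟩ := h2
        have hi' : |ξ i| ≤ s / 2 := by simpa using hξ.1 i
        refine Set.mem_iUnion.2 ⟨i, hξ.1, ?_⟩
        rw [abs_le] at hi'
        rcases lt_abs.1 hi with h | h
        · exact Or.inr ⟨h.le, hi'.2⟩
        · exact Or.inl ⟨hi'.1, by linarith⟩
    _ ≤ ∑ i : Fin d, volume {ξ ∈ cube s (0 : Space d) | ξ i ∈ T} := measure_iUnion_fintype_le _ _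
    _ ≤ ∑ _i : Fin d, ENNReal.ofReal ε * ENNReal.ofReal s ^ (d - 1) := by
        gcongr with i
        exact (volume_slab_le i s 0 hTm).trans (by gcongr)
    _ = _ := by simp

lemma abs_eq_of_mem_frontier_cube {s : ℝ} {ξ : Space d} (h : ξ ∈ frontier (cube s 0)) :
    ∃ i, |ξ i| = s / 2 := by
  by_contra! hne
  have hcl : ξ ∈ cube s 0 := (isClosed_cube s 0).frontier_subset h
  have hlt : ∀ i, |ξ i| < s / 2 := fun i => lt_of_le_of_ne (by simpa using hcl i) (hne i)
  have ho : IsOpen {η : Space d | ∀ i, |η i| < s / 2} := by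
    rw [Set.ofPred_forall]
    exact isOpen_iInter_of_finite fun i => isOpen_lt (by fun_prop) continuous_const
  refine h.2 (mem_interior.2 ⟨_, fun η hη i => ?_, ho, hlt⟩)
  simpa using (hη i).le

lemma frontier_cube_nonempty (hd : 1 ≤ d) {s : ℝ} (hs : 0 < s) :
    (frontier (cube s (0 : Space d))).Nonempty := by
  refine nonempty_frontier_iff.2 ⟨⟨0, mem_cube_self hs.le 0⟩, fun h => ?_⟩
  have : WithLp.toLp 2 (fun _ => s) ∈ cube s (0 : Space d) := h ▸ Set.mem_univ _
  have := this ⟨0, hd⟩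
  simp [abs_of_pos hs] at this
  linarith

/-- A frontier point has a coordinate equal to `±s / 2`, so a point within `ε` of it has that
coordinate within `ε` of the same value. -/
lemma volume_near_frontier_le (hd : 1 ≤ d) {s ε : ℝ} (hs : 0 < s) :
    volume {ξ ∈ cube (3 * s) (0 : Space d) | Metric.infDist ξ (frontier (cube s 0)) < ε} ≤
      d * (2 * ENNReal.ofReal (2 * ε) * ENNReal.ofReal (3 * s) ^ (d - 1)) := by
  set T : Set ℝ := Metric.ball (s / 2) ε ∪ Metric.ball (-(s / 2)) ε with hT
  have hTm : MeasurableSet T := measurableSet_ball.union measurableSet_ball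
  have hTv : volume T ≤ 2 * ENNReal.ofReal (2 * ε) := by
    refine (measure_union_le _ _).trans_eq ?_
    rw [Real.volume_ball, Real.volume_ball, ← two_mul]
  calc _ ≤ volume (⋃ i, {ξ ∈ cube (3 * s) (0 : Space d) | ξ i ∈ T}) := by
        refine measure_mono fun ξ hξ => ?_
        obtain ⟨η, hη, hd⟩ := (Metric.infDist_lt_iff (frontier_cube_nonempty hd hs)).1 hξ.2
        obtain ⟨i, hi⟩ := abs_eq_of_mem_frontier_cube hη
        have hle : dist (ξ i) (η i) < ε :=
          lt_of_le_of_lt (PiLp.lipschitzWith_ofLp 2 (fun _ : Fin d => ℝ) |>.dist_le_mul ξ η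
            |> fun h => (dist_le_pi_dist ξ.ofLp η.ofLp i).trans (by simpa using h)) hd
        refine Set.mem_iUnion.2 ⟨i, hξ.1, ?_⟩
        rcases eq_or_eq_neg_of_abs_eq hi with h | h <;> rw [h] at hle
        · exact Or.inl hle
        · exact Or.inr hle
    _ ≤ ∑ i : Fin d, volume {ξ ∈ cube (3 * s) (0 : Space d) | ξ i ∈ T} :=
        measure_iUnion_fintype_le _ _
    _ ≤ ∑ _i : Fin d, 2 * ENNReal.ofReal (2 * ε) * ENNReal.ofReal (3 * s) ^ (d - 1) := by
        gcongr with i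
        exact (volume_slab_le i _ 0 hTm).trans (by gcongr)
    _ = _ := by simp

lemma infDist_frontier_cube_le {s : ℝ} (hs : 0 < s) {ξ : Space d} (hξ : ξ ∈ cube (3 * s) 0) :
    Metric.infDist ξ (frontier (cube s 0)) ≤ d * (3 * s) := by
  rcases (frontier (cube s (0 : Space d))).eq_empty_or_nonempty with h | ⟨η, hη⟩
  -- The distance to an empty frontier is `0` by convention; this covers `d = 0`.
  · rw [h, Metric.infDist_empty]; positivity
  · refine (Metric.infDist_le_dist_of_mem hη).trans ?_
    have h1 := dist_le_of_mem_cube (by linarith) hξ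
    have h2 := dist_le_of_mem_cube (by linarith)
      (cube_mono (by linarith : s ≤ 3 * s) 0 ((isClosed_cube s 0).frontier_subset hη))
    have := dist_triangle_right ξ η 0
    linarith

/-- The distance from a point of a cube to an adjacent cube is attained by moving along one
coordinate. -/
lemma infDist_adjacent_cube {s : ℝ} {z z' : Fin d → ℤ} {i : Fin d} {σ : ℤ}
    (hσ : σ = 1 ∨ σ = -1) (hz' : z' = Function.update z i (z i + σ)) {ξ : Space d}
    (hξ : ξ ∈ cube s (scaled s z)) :
    Metric.infDist ξ (cube s (scaled s z')) = s / 2 - σ * (ξ i - scaled s z i) := by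
  subst hz'
  have hi := hξ i
  have hσ' : (σ : ℝ) = 1 ∨ (σ : ℝ) = -1 := by
    rcases hσ with rfl | rfl <;> simp
  have hσσ : (σ : ℝ) * σ = 1 := by rcases hσ' with h | h <;> rw [h] <;> norm_num
  have hs : 0 ≤ s := by have := abs_nonneg (ξ i - scaled s z i); linarith
  have hnn : 0 ≤ s / 2 - σ * (ξ i - scaled s z i) := by
    rw [abs_le] at hi
    rcases hσ' with h | h <;> rw [h] <;> linarith
  simp only [scaled] at *
  apply le_antisymm
  -- Upper bound: `η` is the projection of `ξ` to the common face of the two cubes.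
  · set η : Space d := WithLp.toLp 2 (Function.update ξ.ofLp i (s * z i + σ * (s / 2))) with hη
    have hmem : η ∈ cube s (scaled s (Function.update z i (z i + σ))) := by
      intro j
      by_cases hj : j = i
      · subst hj
        simp only [hη, scaled, Function.update_self, Int.cast_add]
        rcases hσ' with h | h <;> rw [h, abs_le] <;> constructor <;> linarith
      · simpa [hη, scaled, Function.update_of_ne hj] using hξ j
    refine (Metric.infDist_le_dist_of_mem hmem).trans ?_
    have : ξ - η = PiLp.single 2 i (ξ i - (s * z i + σ * (s / 2))) := by
      ext j
      by_cases hj : j = i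
      · subst hj; simp [hη]
      · simp [hη, hj]
    rw [dist_eq_norm, this, PiLp.norm_single, Real.norm_eq_abs]
    refine abs_le_of_sq_le_sq ?_ hnn
    apply le_of_eq
    rcases hσ' with h | h <;> rw [h] <;> ring
  -- Lower bound: coordinate `i` alone already forces this distance.
  · refine (Metric.le_infDist ⟨_, mem_cube_self hs _⟩).2 fun η hη => ?_
    have h1 := hη i
    simp only [Function.update_self, Int.cast_add] at h1
    have h2 : |ξ i - η i| ≤ dist ξ η := by
      have := PiLp.norm_apply_le (ξ - η) i
      rwa [← dist_eq_norm] at this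
    refine le_trans ?_ h2
    rw [abs_le] at h1
    rcases hσ' with h | h <;> rw [h] at h1 ⊢
    · refine le_trans ?_ (neg_le_abs _); linarith
    · refine le_trans ?_ (le_abs_self _); linarith

lemma eq_update_of_sum_abs_sub_eq_one {z z' : Fin d → ℤ} (h : ∑ i, |z i - z' i| = 1) :
    ∃ i, ∃ σ : ℤ, (σ = 1 ∨ σ = -1) ∧ z' = Function.update z i (z i + σ) := by
  obtain ⟨i, hi⟩ : ∃ i, z i ≠ z' i := by
    by_contra! hne
    simp [hne] at h
  rw [← Finset.add_sum_erase _ _ (Finset.mem_univ i)] at h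
  have h1 : 1 ≤ |z i - z' i| := Int.one_le_abs (sub_ne_zero.2 hi)
  have h2 : 0 ≤ ∑ j ∈ Finset.univ.erase i, |z j - z' j| :=
    Finset.sum_nonneg fun _ _ => abs_nonneg _
  have h3 : |z i - z' i| = 1 := by omega
  have h4 : ∑ j ∈ Finset.univ.erase i, |z j - z' j| = 0 := by omega
  rw [Finset.sum_eq_zero_iff_of_nonneg fun _ _ => abs_nonneg _] at h4
  refine ⟨i, z' i - z i, ?_, ?_⟩
  · rcases eq_or_eq_neg_of_abs_eq h3 with h | h <;> omega
  · ext j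
    by_cases hj : j = i
    · subst hj; simp
    · rw [Function.update_of_ne hj]
      have := h4 j (by simp [hj])
      rw [abs_eq_zero] at this
      omega

lemma finite_sites : (sites d).Finite := by
  refine (Set.Finite.pi' fun _ : Fin d => Set.finite_Icc (-2 : ℤ) 2).subset ?_
  intro z hz i
  have := hz i
  simp only [scaled, one_mul, PiLp.zero_apply, sub_zero, abs_le] at this
  have h1 : (-2 : ℝ) ≤ (z i : ℝ) := by linarith
  have h2 : (z i : ℝ) ≤ 2 := by linarith
  exact ⟨by exact_mod_cast h1, by exact_mod_cast h2⟩

lemma volume_annulus_le (hd : 1 ≤ d) (x : Space d) {ρ ε R : ℝ} (hε : 0 ≤ ε) (hρ : 0 ≤ ρ)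
    (hR : ρ + ε ≤ R) :
    volume {y : Space d | |dist x y - ρ| ≤ ε} ≤
      ENNReal.ofReal (2 * ε * d * R ^ (d - 1)) * volume (Metric.ball (0 : Space d) 1) := by
  have : Nonempty (Fin d) := ⟨⟨0, hd⟩⟩
  set a := ρ + ε
  -- The inner radius is truncated at `0` so that the ball volume formula applies; then `a ^ d - b ^
  -- d ≤ (a - b) * d * a ^ (d - 1)`.
  set b := max (ρ - ε) 0
  have hb : 0 ≤ b := le_max_right _ _
  have ha : 0 ≤ a := by positivity
  have hba : b ≤ a := max_le (by simp only [a]; linarith) ha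
  have hab : a - b ≤ 2 * ε := by have := le_max_left (ρ - ε) 0; simp only [a, b]; linarith
  have hsub : {y : Space d | |dist x y - ρ| ≤ ε} ⊆ Metric.closedBall x a \ Metric.ball x b := by
    intro y hy
    rw [Set.mem_ofPred_eq, abs_le] at hy
    rw [Set.mem_sdiff, Metric.mem_closedBall, Metric.mem_ball, not_lt, dist_comm]
    exact ⟨by simp only [a]; linarith, max_le (by linarith) dist_nonneg⟩
  refine (measure_mono hsub).trans ?_
  rw [measure_sdiff ((Metric.ball_subset_ball hba).trans Metric.ball_subset_closedBall)
    measurableSet_ball.nullMeasurableSet measure_ball_lt_top.ne, Measure.addHaar_closedBall _ _ ha,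
    Measure.addHaar_ball _ _ hb, ← ENNReal.sub_mul (fun _ _ => measure_ball_lt_top.ne),
    ← ENNReal.ofReal_sub _ (by positivity)]
  gcongr
  have h1 := abs_pow_sub_pow_le a b (Module.finrank ℝ (Space d))
  rw [abs_of_nonneg ha, abs_of_nonneg hb, max_eq_left hba, abs_of_nonneg (sub_nonneg.2 hba)] at h1
  refine (le_abs_self _).trans (h1.trans ?_)
  rw [finrank_euclideanSpace_fin]
  gcongr

end Cubes

/-! ### Exceptional sets of tuples and their volumes -/

section TupleSets

variable {d : ℕ}

/-- Some `n` distinct locations of `φ` form an element of `C`. -/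
def HasTuple {d K n : ℕ} (φ : Config d K) (C : Set (Fin n → Space d)) : Prop :=
  ∃ x ∈ C, Function.Injective x ∧ ∀ i, ∃ k, (x i, k) ∈ φ

/-- Tuples of points of the cube `Q_{3s}(o)`. -/
def cubeTuples (d n : ℕ) (s : ℝ) : Set (Fin n → Space d) :=
  Set.univ.pi fun _ => cube (3 * s) 0

/-- Triples in `Q_{3s}(o)` whose first point is equidistant from the two others. -/
def isoscelesTriples (d : ℕ) (s : ℝ) : Set (Fin 3 → Space d) :=
  cubeTuples d 3 s ∩ {x | dist (x 0) (x 1) = dist (x 0) (x 2)}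

/-- Quadruples in `Q_{3s}(o)` with two equal disjoint distances. -/
def equidistantQuadruples (d : ℕ) (s : ℝ) : Set (Fin 4 → Space d) :=
  cubeTuples d 4 s ∩ {x | dist (x 0) (x 1) = dist (x 2) (x 3)}

/-- Pairs in `Q_{3s}(o)` whose distance agrees up to `ε` with the distance of the first point
to the boundary of `Q_s(o)`. -/
def annulusPairs (d : ℕ) (s ε : ℝ) : Set (Fin 2 → Space d) :=
  cubeTuples d 2 s ∩
    {x | |dist (x 0) (x 1) - Metric.infDist (x 0) (frontier (cube s 0))| ≤ ε}

lemma isCompact_cubeTuples (n : ℕ) {s : ℝ} (hs : 0 ≤ s) : IsCompact (cubeTuples d n s) :=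
  isCompact_univ_pi fun _ => isCompact_cube (by positivity) 0

lemma isCompact_isoscelesTriples {s : ℝ} (hs : 0 ≤ s) : IsCompact (isoscelesTriples d s) :=
  (isCompact_cubeTuples 3 hs).inter_right (isClosed_eq (by fun_prop) (by fun_prop))

lemma isCompact_equidistantQuadruples {s : ℝ} (hs : 0 ≤ s) :
    IsCompact (equidistantQuadruples d s) :=
  (isCompact_cubeTuples 4 hs).inter_right (isClosed_eq (by fun_prop) (by fun_prop))

lemma isCompact_annulusPairs {s : ℝ} (hs : 0 ≤ s) (ε : ℝ) : IsCompact (annulusPairs d s ε) := by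
  have hc : Continuous fun x : Fin 2 → Space d =>
      |dist (x 0) (x 1) - Metric.infDist (x 0) (frontier (cube s 0))| :=
    ((by fun_prop : Continuous fun x : Fin 2 → Space d => dist (x 0) (x 1)).sub
      ((Metric.continuous_infDist_pt _).comp (continuous_apply 0))).abs
  exact (isCompact_cubeTuples 2 hs).inter_right (isClosed_le hc continuous_const)

lemma volume_tuples_le_of_slice_le {n : ℕ} (i : Fin (n + 1)) {s : ℝ}
    {A : Set (Fin (n + 1) → Space d)} (hA : IsCompact A) (hAs : A ⊆ cubeTuples d (n + 1) s)
    {c : ℝ≥0∞} (hc : ∀ x ∈ A, volume {t | Function.update x i t ∈ A} ≤ c) :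
    volume A ≤ c * (ENNReal.ofReal (3 * s) ^ d) ^ n :=
  measure_pi_le_of_slice_le volume i hA.measurableSet hAs
    (fun _ => (isClosed_cube _ _).measurableSet) (fun _ => (volume_cube _ _).le) hc

/-- With the first two points fixed, the third is confined to a sphere, which is null. -/
lemma volume_isoscelesTriples (hd : 1 ≤ d) {s : ℝ} (hs : 0 ≤ s) :
    volume (isoscelesTriples d s) = 0 := by
  have : Nonempty (Fin d) := ⟨⟨0, hd⟩⟩
  rw [← nonpos_iff_eq_zero]
  refine (volume_tuples_le_of_slice_le 2 (isCompact_isoscelesTriples hs)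
    Set.inter_subset_left (c := 0) fun x _ => ?_).trans_eq (zero_mul _)
  refine (measure_mono (t := Metric.sphere (x 0) (dist (x 0) (x 1))) fun t ht => ?_).trans_eq
    (Measure.addHaar_sphere _ _ _)
  have := ht.2
  rw [Set.mem_ofPred_eq, Function.update_of_ne (by decide), Function.update_of_ne (by decide),
    Function.update_self] at this
  rw [Metric.mem_sphere, dist_comm, this]

lemma volume_equidistantQuadruples (hd : 1 ≤ d) {s : ℝ} (hs : 0 ≤ s) :
    volume (equidistantQuadruples d s) = 0 := by
  have : Nonempty (Fin d) := ⟨⟨0, hd⟩⟩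
  rw [← nonpos_iff_eq_zero]
  refine (volume_tuples_le_of_slice_le 3 (isCompact_equidistantQuadruples hs)
    Set.inter_subset_left (c := 0) fun x _ => ?_).trans_eq (zero_mul _)
  refine (measure_mono (t := Metric.sphere (x 2) (dist (x 0) (x 1))) fun t ht => ?_).trans_eq
    (Measure.addHaar_sphere _ _ _)
  have := ht.2
  rw [Set.mem_ofPred_eq, Function.update_of_ne (by decide), Function.update_of_ne (by decide),
    Function.update_of_ne (by decide), Function.update_self] at this
  rw [Metric.mem_sphere, dist_comm, this]

/-- With the first point fixed, the second lies in an annulus of width at most `2 * ε` and outer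
radius at most `R`. -/
lemma volume_annulusPairs_le (hd : 1 ≤ d) {s ε R : ℝ} (hs : 0 < s) (hε : 0 ≤ ε)
    (hR : d * (3 * s) + ε ≤ R) :
    volume (annulusPairs d s ε) ≤ ENNReal.ofReal (2 * ε * d * R ^ (d - 1)) *
      volume (Metric.ball (0 : Space d) 1) * ENNReal.ofReal (3 * s) ^ d := by
  refine (volume_tuples_le_of_slice_le 1 (isCompact_annulusPairs hs.le ε)
    Set.inter_subset_left fun x hx => ?_).trans_eq (by rw [pow_one])
  refine (measure_mono fun t ht => ?_).trans (volume_annulus_le hd (x 0) hε Metric.infDist_nonneg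
    ((add_le_add_left (infDist_frontier_cube_le hs (hx.1 0 trivial)) ε).trans hR))
  have := ht.2
  rw [Set.mem_ofPred_eq, Function.update_of_ne (by decide), Function.update_self] at this
  exact this

end TupleSets

/-! ### Configurations avoiding the exceptional sets are good -/

section Deterministic

variable {d K : ℕ} {φ : Config d K} {s : ℝ}

lemma inter_mem_LocFin (hφ : φ ∈ LocFin d K) (A : Config d K) : φ ∩ A ∈ LocFin d K :=
  fun B hB => (hφ B hB).subset (Set.inter_subset_inter_left _ Set.inter_subset_left)

/-- Two different pairs of locations with equal distance either share exactly one endpoint, giving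
an isosceles triple, or are disjoint, giving a quadruple. -/
lemma dist_ne_of_not_hasTuple (h3 : ¬ HasTuple φ (isoscelesTriples d s))
    (h4 : ¬ HasTuple φ (equidistantQuadruples d s)) {x₁ x₂ y₁ y₂ : Space d × Mark K}
    (hx₁ : x₁ ∈ φ ∩ marked K (cube (3 * s) 0)) (hx₂ : x₂ ∈ φ ∩ marked K (cube (3 * s) 0))
    (hy₁ : y₁ ∈ φ ∩ marked K (cube (3 * s) 0)) (hy₂ : y₂ ∈ φ ∩ marked K (cube (3 * s) 0))
    (hx : x₁.1 ≠ x₂.1) (hxy : ({x₁.1, x₂.1} : Set (Space d)) ≠ {y₁.1, y₂.1}) :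
    dist x₁.1 x₂.1 ≠ dist y₁.1 y₂.1 := by
  intro he
  have hy : y₁.1 ≠ y₂.1 := by
    intro h
    rw [h, dist_self] at he
    exact hx (dist_eq_zero.1 he)
  have triple : ∀ {a b c : Space d × Mark K}, a ∈ φ ∩ marked K (cube (3 * s) 0) →
      b ∈ φ ∩ marked K (cube (3 * s) 0) → c ∈ φ ∩ marked K (cube (3 * s) 0) →
      a.1 ≠ b.1 → a.1 ≠ c.1 → b.1 ≠ c.1 → dist a.1 b.1 = dist a.1 c.1 → False := by
    intro a b c ha hb hc hab hac hbc h
    refine h3 ⟨![a.1, b.1, c.1], ⟨?_, h⟩, ?_, ?_⟩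
    · intro i _
      fin_cases i
      exacts [ha.2.1, hb.2.1, hc.2.1]
    · intro i j hij
      fin_cases i <;> fin_cases j <;> first
        | rfl
        | exact absurd hij hab
        | exact absurd hij.symm hab
        | exact absurd hij hac
        | exact absurd hij.symm hac
        | exact absurd hij hbc
        | exact absurd hij.symm hbc
    · intro i
      fin_cases i
      exacts [⟨a.2, ha.1⟩, ⟨b.2, hb.1⟩, ⟨c.2, hc.1⟩]
  by_cases h11 : x₁.1 = y₁.1
  · refine triple hx₁ hx₂ hy₂ hx (h11 ▸ hy) (fun h => hxy (by rw [h11, h])) ?_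
    rw [he, h11]
  by_cases h12 : x₁.1 = y₂.1
  · refine triple hx₁ hx₂ hy₁ hx h11 (fun h => hxy (by rw [h12, h, Set.pair_comm])) ?_
    rw [he, h12, dist_comm]
  by_cases h21 : x₂.1 = y₁.1
  · refine triple hx₂ hx₁ hy₂ hx.symm (h21 ▸ hy) h12 ?_
    rw [dist_comm, he, h21]
  by_cases h22 : x₂.1 = y₂.1
  · refine triple hx₂ hx₁ hy₁ hx.symm h21 h11 ?_
    rw [dist_comm, he, h22, dist_comm]
  refine h4 ⟨![x₁.1, x₂.1, y₁.1, y₂.1], ⟨?_, he⟩, ?_, ?_⟩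
  · intro i _
    fin_cases i
    exacts [hx₁.2.1, hx₂.2.1, hy₁.2.1, hy₂.2.1]
  · intro i j hij
    fin_cases i <;> fin_cases j <;> first
      | rfl
      | exact absurd hij hx
      | exact absurd hij.symm hx
      | exact absurd hij hy
      | exact absurd hij.symm hy
      | exact absurd hij h11
      | exact absurd hij.symm h11
      | exact absurd hij h12
      | exact absurd hij.symm h12
      | exact absurd hij h21
      | exact absurd hij.symm h21
      | exact absurd hij h22
      | exact absurd hij.symm h22
  · intro i
    fin_cases i
    exacts [⟨_, hx₁.1⟩, ⟨_, hx₂.1⟩, ⟨_, hy₁.1⟩, ⟨_, hy₂.1⟩]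

lemma inter_mem_A1 (hφ : φ ∈ LocFin d K) (hs : 0 ≤ s)
    (h1 : ∀ j, ((K + 1 : ℕ) : ℕ∞) ≤ (φ ∩ marked K (subcube s j)).encard)
    (h3 : ¬ HasTuple φ (isoscelesTriples d s)) (h4 : ¬ HasTuple φ (equidistantQuadruples d s)) :
    φ ∩ marked K (cube (3 * s) 0) ∈ A1 d K s := by
  have hcount : ∀ j, ((K + 1 : ℕ) : ℕ∞) ≤
      (φ ∩ marked K (cube (3 * s) 0) ∩ marked K (subcube s j)).encard := fun j =>
    (h1 j).trans (Set.encard_le_encard fun x hx =>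
      ⟨⟨hx.1, subcube_subset hs j hx.2.1, trivial⟩, hx.2⟩)
  refine ⟨⟨inter_mem_LocFin hφ _, ?_, ?_⟩, hcount⟩
  -- Any single subcube already supplies `K + 1` points.
  · exact (hcount fun _ => 0).trans (Set.encard_le_encard Set.inter_subset_left)
  · intro x₁ hx₁ x₂ hx₂ y₁ hy₁ y₂ hy₂ hx hxy
    exact dist_ne_of_not_hasTuple h3 h4 hx₁ hx₂ hy₁ hy₂ hx hxy

lemma inter_mem_A2 (hφ : φ ∈ LocFin d K)
    (h : ¬ ∃ x ∈ φ, x.1 ∈ cube s 0 \ cube (s - s ^ (-(d : ℤ))) 0) (A : Config d K) :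
    φ ∩ A ∈ A2 d K s := by
  refine ⟨inter_mem_LocFin hφ _, Set.eq_empty_iff_forall_notMem.2 fun x hx => ?_⟩
  exact h ⟨x, hx.1.1, hx.2.1⟩

/-- Two obstructions arise. A point at the location of `x`, including `x` itself, lies in the
annulus only if the inner ball is empty, that is, if `x` is too close to the frontier. A point
elsewhere forms an annulus pair with `x`. -/
lemma inter_mem_A3 (hφ : φ ∈ LocFin d K)
    (h1 : ¬ ∃ x ∈ φ, x.1 ∈ {ξ ∈ cube (3 * s) (0 : Space d) |
      Metric.infDist ξ (frontier (cube s 0)) < s ^ (-(2 * d : ℤ))})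
    (h2 : ¬ HasTuple φ (annulusPairs d s (s ^ (-(2 * d : ℤ))))) :
    φ ∩ marked K (cube (3 * s) 0) ∈ A3 d K s := by
  refine ⟨inter_mem_LocFin hφ _, fun x hx => Set.eq_empty_iff_forall_notMem.2 fun y hy => ?_⟩
  obtain ⟨hy1, hy2⟩ := hy.2.1
  rw [Metric.mem_closedBall, dist_comm] at hy1 hy2
  rw [not_le] at hy2
  by_cases hxy : x.1 = y.1
  · refine h1 ⟨x, hx.1.1, hx.2.1, ?_⟩
    rw [← hxy, dist_self] at hy2
    linarith
  · refine h2 ⟨![x.1, y.1], ⟨?_, ?_⟩, ?_, ?_⟩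
    · intro i _
      fin_cases i
      exacts [hx.2.1, hy.1.2.1]
    · change |dist x.1 y.1 - _| ≤ _
      rw [abs_le]
      constructor <;> simp only [Matrix.cons_val_zero] <;> linarith
    · intro i j hij
      fin_cases i <;> fin_cases j <;> simp_all
    · intro i
      fin_cases i
      exacts [⟨_, hx.1.1⟩, ⟨_, hy.1.1⟩]

/-- Locations in `Q_s(sz)` whose distances to two adjacent cubes differ by less than `s^{-d}`;
the adjacent cubes are given by a coordinate and a sign each. -/
def obliqueSlab (d : ℕ) (s : ℝ) (p : (Fin d → ℤ) × (Fin d × ℤ) × (Fin d × ℤ)) :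
    Set (Space d) :=
  {ξ ∈ cube s (scaled s p.1) |
    |(p.2.1.2 : ℝ) * (ξ p.2.1.1 - scaled s p.1 p.2.1.1) -
      (p.2.2.2 : ℝ) * (ξ p.2.2.1 - scaled s p.1 p.2.2.1)| < s ^ (-(d : ℤ))}

/-- The sites of `Q_3(o)` with pairs of distinct signed coordinate directions. -/
noncomputable def slabIndices (d : ℕ) : Finset ((Fin d → ℤ) × (Fin d × ℤ) × (Fin d × ℤ)) :=
  {p ∈ finite_sites.toFinset ×ˢ (Finset.univ ×ˢ {1, -1}) ×ˢ (Finset.univ ×ˢ {1, -1}) |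
    p.2.1 ≠ p.2.2}

lemma inter_mem_A4 (hφ : φ ∈ LocFin d K)
    (h : ∀ p ∈ slabIndices d, ¬ ∃ x ∈ φ, x.1 ∈ obliqueSlab d s p) (A : Config d K) :
    φ ∩ A ∈ A4 d K s := by
  refine ⟨inter_mem_LocFin hφ _, fun z hz z₁ _ z₂ _ h₁ h₂ hne x hx => ?_⟩
  obtain ⟨i, σ, hσ, hi⟩ := eq_update_of_sum_abs_sub_eq_one h₁
  obtain ⟨j, τ, hτ, hj⟩ := eq_update_of_sum_abs_sub_eq_one h₂
  by_contra! hlt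
  -- Both distances are `s / 2` minus a signed coordinate, so `s / 2` cancels and a slab condition
  -- remains.
  rw [infDist_adjacent_cube hσ hi hx.2.1, infDist_adjacent_cube hτ hj hx.2.1] at hlt
  refine h (z, (i, σ), (j, τ)) ?_ ⟨x, hx.1.1, hx.2.1, ?_⟩
  · simp only [slabIndices, Finset.mem_filter, Finset.mem_product, Set.Finite.mem_toFinset,
      Finset.mem_univ, Finset.mem_insert, Finset.mem_singleton, true_and]
    refine ⟨⟨hz, hσ, hτ⟩, fun he => hne ?_⟩
    rw [Prod.mk.injEq] at he
    rw [hi, hj, he.1, he.2]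
  · rw [abs_sub_comm] at hlt
    refine lt_of_eq_of_lt (congrArg _ ?_) hlt
    ring

end Deterministic

/-! ### Powers of `s` -/

lemma zpow_neg_mul_pow_pred {d : ℕ} (hd : 1 ≤ d) {s : ℝ} (hs : 1 < s) :
    s ^ (-(d : ℤ)) * s ^ (d - 1) = s⁻¹ := by
  obtain ⟨n, rfl⟩ := Nat.exists_eq_add_of_le' hd
  have : s ≠ 0 := by positivity
  rw [zpow_neg, zpow_natCast, Nat.add_sub_cancel, pow_succ]
  field_simp

lemma zpow_neg_two_mul_mul_pow {d : ℕ} (hd : 1 ≤ d) {s : ℝ} (hs : 1 < s) :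
    s ^ (-(2 * d : ℤ)) * (s ^ (d - 1) * s ^ d) = s⁻¹ := by
  obtain ⟨n, rfl⟩ := Nat.exists_eq_add_of_le' hd
  have : s ≠ 0 := by positivity
  rw [zpow_neg, show (2 * ((n + 1 : ℕ) : ℤ)) = ((n + (n + 1) + 1 : ℕ) : ℤ) by push_cast; ring,
    zpow_natCast, Nat.add_sub_cancel, ← pow_add, pow_succ]
  field_simp

lemma zpow_neg_two_mul_le {d : ℕ} {s : ℝ} (hs : 1 < s) :
    s ^ (-(2 * d : ℤ)) ≤ s ^ (-(d : ℤ)) :=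
  zpow_le_zpow_right₀ hs.le (by omega)

lemma tendsto_zero_of_le_ofReal_mul_inv {f : ℝ → ℝ≥0∞} (c : ℝ)
    (h : ∀ s : ℝ, 1 < s → f s ≤ ENNReal.ofReal (c * s⁻¹)) : Tendsto f atTop (𝓝 0) := by
  have h1 := ENNReal.tendsto_ofReal (tendsto_inv_atTop_zero.const_mul c : Tendsto _ atTop _)
  rw [mul_zero, ENNReal.ofReal_zero] at h1
  refine tendsto_of_tendsto_of_tendsto_of_le_of_le' tendsto_const_nhds h1
    (Eventually.of_forall fun _ => zero_le) ?_
  filter_upwards [eventually_gt_atTop 1] with s hs using h s hs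

/-! ### Probabilities of the bad events -/

section Bounds

variable {Ω : Type*} [MeasurableSpace Ω] {d K : ℕ} {P : Measure Ω} {γ : ℝ}
  {π : Measure (Mark K)} [IsProbabilityMeasure π] {X : Ω → Config d K} {s : ℝ}

namespace IsIndepMarkedPoisson

lemma measure_exists_mem_le (hX : IsIndepMarkedPoisson P γ π X) (hγ : γ ≤ 1) {B : Set (Space d)}
    (hB : MeasurableSet B) (hB' : volume B ≠ ⊤) :
    P {ω | ∃ x ∈ X ω, x.1 ∈ B} ≤ volume B := by
  refine (measure_mono fun ω hω => ?_).trans ((hX.measure_nonempty_le hB hB').trans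
    (mul_le_of_le_one_left' (ENNReal.ofReal_le_one.2 hγ)))
  obtain ⟨x, hx, hxB⟩ := hω
  exact one_le_encard_inter_marked hx hxB

lemma measure_hasTuple_le [IsProbabilityMeasure P] (hX : IsIndepMarkedPoisson P γ π X)
    (hγ : γ ≤ 1) (hd : 1 ≤ d) {n : ℕ} {C : Set (Fin n → Space d)} (hC : IsCompact C) :
    P {ω | HasTuple (X ω) C} ≤ volume C :=
  (hX.measure_exists_tuple_le hC hd).trans
    (mul_le_of_le_one_left' (pow_le_one' (ENNReal.ofReal_le_one.2 hγ) n))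

lemma measure_not_A2_le (hX : IsIndepMarkedPoisson P γ π X) (hγ : γ ≤ 1) (hd : 1 ≤ d)
    (hs : 1 < s) :
    P {ω | ∃ x ∈ X ω, x.1 ∈ cube s 0 \ cube (s - s ^ (-(d : ℤ))) 0} ≤
      ENNReal.ofReal (d * s⁻¹) := by
  have hfin : volume (cube s (0 : Space d) \ cube (s - s ^ (-(d : ℤ))) 0) ≠ ⊤ :=
    ne_top_of_le_ne_top (by rw [volume_cube]; simp) (measure_mono Set.sdiff_subset)
  refine (hX.measure_exists_mem_le hγ ((isClosed_cube _ _).measurableSet.diff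
    (isClosed_cube _ _).measurableSet) hfin).trans (volume_cube_diff_cube_le.trans_eq ?_)
  rw [← ENNReal.ofReal_pow (by positivity), ← ENNReal.ofReal_mul (by positivity),
    zpow_neg_mul_pow_pred hd hs, ENNReal.ofReal_mul (by positivity), ENNReal.ofReal_natCast]

lemma measure_near_frontier_le (hX : IsIndepMarkedPoisson P γ π X) (hγ : γ ≤ 1) (hd : 1 ≤ d)
    (hs : 1 < s) :
    P {ω | ∃ x ∈ X ω, x.1 ∈ {ξ ∈ cube (3 * s) (0 : Space d) |
        Metric.infDist ξ (frontier (cube s 0)) < s ^ (-(2 * d : ℤ))}} ≤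
      ENNReal.ofReal (d * (2 * 2 * 3 ^ (d - 1)) * s⁻¹) := by
  set A := {ξ ∈ cube (3 * s) (0 : Space d) |
    Metric.infDist ξ (frontier (cube s 0)) < s ^ (-(2 * d : ℤ))}
  have hA : MeasurableSet A := (isClosed_cube _ _).measurableSet.inter
    (isOpen_lt (Metric.continuous_infDist_pt _) continuous_const).measurableSet
  have hfin : volume A ≠ ⊤ :=
    ne_top_of_le_ne_top (isCompact_cube (by positivity : 0 ≤ 3 * s) 0).measure_lt_top.ne
      (measure_mono (Set.sep_subset (cube (3 * s) 0) _))
  refine (hX.measure_exists_mem_le hγ hA hfin).trans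
    ((volume_near_frontier_le hd (by positivity)).trans ?_)
  rw [← ENNReal.ofReal_natCast, ← ENNReal.ofReal_ofNat, ← ENNReal.ofReal_pow (by positivity),
    ← ENNReal.ofReal_mul (by positivity), ← ENNReal.ofReal_mul (by positivity),
    ← ENNReal.ofReal_mul (by positivity)]
  apply ENNReal.ofReal_le_ofReal
  rw [← zpow_neg_mul_pow_pred hd hs, mul_pow]
  calc _ = (d * (2 * 2 * 3 ^ (d - 1)) : ℝ) * (s ^ (-(2 * d : ℤ)) * s ^ (d - 1)) := by ring
    _ ≤ _ := by gcongr ?_ * (?_ * ?_); exact zpow_neg_two_mul_le hs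

lemma measure_annulusPairs_le [IsProbabilityMeasure P] (hX : IsIndepMarkedPoisson P γ π X)
    (hγ : γ ≤ 1) (hd : 1 ≤ d) (hs : 1 < s) :
    P {ω | HasTuple (X ω) (annulusPairs d s (s ^ (-(2 * d : ℤ))))} ≤
      ENNReal.ofReal (2 * d * (4 * d) ^ (d - 1) * (volume (Metric.ball (0 : Space d) 1)).toReal *
        3 ^ d * s⁻¹) := by
  have hε : s ^ (-(2 * d : ℤ)) ≤ 1 := zpow_le_one_of_nonpos₀ hs.le (by omega)
  have hd' : (1 : ℝ) ≤ d := by exact_mod_cast hd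
  refine (hX.measure_hasTuple_le hγ hd (isCompact_annulusPairs (by positivity) _)).trans
    -- This radius suffices because `s ^ (-2d) ≤ 1 ≤ d * s`.
    ((volume_annulusPairs_le hd (R := 4 * d * s) (by positivity) (by positivity)
      (by nlinarith)).trans_eq ?_)
  rw [← ENNReal.ofReal_toReal (measure_ball_lt_top (μ := volume) (x := (0 : Space d)) (r := 1)).ne,
    ← ENNReal.ofReal_pow (by positivity), ← ENNReal.ofReal_mul (by positivity),
    ← ENNReal.ofReal_mul (by positivity), ENNReal.toReal_ofReal ENNReal.toReal_nonneg,
    ← zpow_neg_two_mul_mul_pow hd hs]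
  congr 1
  rw [mul_pow _ s, mul_pow _ s]
  ring

lemma measure_obliqueSlab_le (hX : IsIndepMarkedPoisson P γ π X) (hγ : γ ≤ 1) (hd : 1 ≤ d)
    (hs : 1 < s) {p : (Fin d → ℤ) × (Fin d × ℤ) × (Fin d × ℤ)} (hp : p ∈ slabIndices d) :
    P {ω | ∃ x ∈ X ω, x.1 ∈ obliqueSlab d s p} ≤ ENNReal.ofReal (2 * s⁻¹) := by
  obtain ⟨z, ⟨i, σ⟩, ⟨j, τ⟩⟩ := p
  simp only [slabIndices, Finset.mem_filter, Finset.mem_product, Finset.mem_univ,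
    Finset.mem_insert, Finset.mem_singleton, true_and] at hp
  obtain ⟨⟨-, hσ, hτ⟩, hne⟩ := hp
  have hm : Measurable fun ξ : Space d =>
      |(σ : ℝ) * (ξ i - scaled s z i) - (τ : ℝ) * (ξ j - scaled s z j)| := by fun_prop
  have hA : MeasurableSet (obliqueSlab d s (z, (i, σ), (j, τ))) :=
    (isClosed_cube _ _).measurableSet.inter (measurableSet_lt hm measurable_const)
  have hfin : volume (obliqueSlab d s (z, (i, σ), (j, τ))) ≠ ⊤ :=
    ne_top_of_le_ne_top (by rw [volume_cube]; simp)
      (measure_mono (Set.sep_subset (cube s (scaled s z)) _))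
  refine (hX.measure_exists_mem_le hγ hA hfin).trans
    ((volume_oblique_slab_le (scaled s z) (by rcases hσ with rfl | rfl <;> simp)
      (by rcases hτ with rfl | rfl <;> simp) fun h h' => hne ?_).trans_eq ?_)
  · exact Prod.ext h (Int.cast_injective h')
  · rw [← ENNReal.ofReal_pow (by positivity), ← ENNReal.ofReal_mul (by positivity), mul_assoc,
      zpow_neg_mul_pow_pred hd hs]

lemma measure_not_A4_le (hX : IsIndepMarkedPoisson P γ π X) (hγ : γ ≤ 1) (hd : 1 ≤ d)
    (hs : 1 < s) :
    P {ω | ∃ p ∈ slabIndices d, ∃ x ∈ X ω, x.1 ∈ obliqueSlab d s p} ≤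
      ENNReal.ofReal ((slabIndices d).card * 2 * s⁻¹) := by
  calc _ = P (⋃ p ∈ slabIndices d, {ω | ∃ x ∈ X ω, x.1 ∈ obliqueSlab d s p}) := by
        congr 1; ext ω; simp
    _ ≤ ∑ p ∈ slabIndices d, P {ω | ∃ x ∈ X ω, x.1 ∈ obliqueSlab d s p} :=
        measure_biUnion_finset_le _ _
    _ ≤ ∑ _p ∈ slabIndices d, ENNReal.ofReal (2 * s⁻¹) :=
        Finset.sum_le_sum fun p hp => hX.measure_obliqueSlab_le hγ hd hs hp
    _ = _ := by
        rw [Finset.sum_const, nsmul_eq_mul, mul_assoc, ← ENNReal.ofReal_natCast,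
          ← ENNReal.ofReal_mul (by positivity)]

lemma measure_count_subcube_lt (hX : IsIndepMarkedPoisson P γ π X)
    (j : Fin d → Fin (3 * (4 * d + 1))) :
    P {ω | (X ω ∩ marked K (subcube s j)).encard < ((K + 1 : ℕ) : ℕ∞)} =
      poissonMeasure (ENNReal.ofReal γ * ENNReal.ofReal (s / (4 * d + 1)) ^ d).toNNReal
        {n | n ≤ K} := by
  have := hX.measure_count_mem (measurableSet_subcube s j) (by rw [volume_subcube]; simp)
    {n | n < ((K + 1 : ℕ) : ℕ∞)}
  simp only [Set.mem_ofPred_eq, Nat.cast_lt, Nat.lt_succ_iff, volume_subcube] at this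
  exact this

end IsIndepMarkedPoisson

end Bounds

/-! ### Passage to the limit -/

section Limit

variable {Ω : Type*} [MeasurableSpace Ω] {d K : ℕ} {P : Measure Ω} {π : Measure (Mark K)}
  [IsProbabilityMeasure π] {X : ℝ → Ω → Config d K}

/-- The intensity tends to `1` while the volume of a subcube tends to infinity. -/
lemma tendsto_subcube_rate (hd : 1 ≤ d) :
    Tendsto (fun s : ℝ => (ENNReal.ofReal (1 - s ^ (-((d : ℤ) + 1))) *
      ENNReal.ofReal (s / (4 * d + 1)) ^ d).toNNReal) atTop atTop := by
  have h1 : Tendsto (fun s : ℝ => (s / (4 * d + 1)) ^ d) atTop atTop :=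
    (tendsto_pow_atTop (by omega)).comp (tendsto_id.atTop_div_const (by positivity))
  have h2 : Tendsto (fun s : ℝ => 1 - s ^ (-((d : ℤ) + 1))) atTop (𝓝 1) := by
    have := (tendsto_const_nhds (x := (1 : ℝ))).sub
      (tendsto_pow_neg_atTop (𝕜 := ℝ) (n := d + 1) (by omega))
    rw [sub_zero] at this
    exact_mod_cast this
  refine (tendsto_real_toNNReal_atTop.comp (h2.pos_mul_atTop one_pos h1)).congr' ?_
  filter_upwards [eventually_gt_atTop 1] with s hs
  have h3 : 0 ≤ s / (4 * d + 1) := by positivity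
  have h4 : s ^ (-((d : ℤ) + 1)) ≤ 1 := zpow_le_one_of_nonpos₀ hs.le (by omega)
  rw [← ENNReal.ofReal_pow h3, ← ENNReal.ofReal_mul (by linarith)]
  rfl

lemma tendsto_measure_count_subcube (hd : 1 ≤ d)
    (hX : ∀ s : ℝ, 1 < s → IsIndepMarkedPoisson P (1 - s ^ (-((d : ℤ) + 1))) π (X s)) :
    Tendsto (fun s : ℝ => P {ω | ∃ j : Fin d → Fin (3 * (4 * d + 1)),
      (X s ω ∩ marked K (subcube s j)).encard < ((K + 1 : ℕ) : ℕ∞)}) atTop (𝓝 0) := by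
  have h : Tendsto (fun s : ℝ => ∑ _j : Fin d → Fin (3 * (4 * d + 1)),
      poissonMeasure (ENNReal.ofReal (1 - s ^ (-((d : ℤ) + 1))) *
        ENNReal.ofReal (s / (4 * d + 1)) ^ d).toNNReal {n | n ≤ K}) atTop (𝓝 0) := by
    have := tendsto_finsetSum (Finset.univ : Finset (Fin d → Fin (3 * (4 * d + 1))))
      fun _ _ => (tendsto_poissonMeasure_le K).comp (tendsto_subcube_rate hd)
    simpa only [Finset.sum_const_zero, Function.comp_def] using this
  refine tendsto_of_tendsto_of_tendsto_of_le_of_le' tendsto_const_nhds h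
    (Eventually.of_forall fun _ => zero_le) ?_
  filter_upwards [eventually_gt_atTop 1] with s hs
  rw [Set.ofPred_exists]
  refine (measure_iUnion_fintype_le _ _).trans ?_
  gcongr with j
  exact ((hX s hs).measure_count_subcube_lt j).le

lemma inter_mem_goodEvent {φ : Config d K} {s : ℝ} (hφ : φ ∈ LocFin d K) (hs : 0 ≤ s)
    (h1 : ¬ ∃ j, (φ ∩ marked K (subcube s j)).encard < ((K + 1 : ℕ) : ℕ∞))
    (h3 : ¬ HasTuple φ (isoscelesTriples d s)) (h4 : ¬ HasTuple φ (equidistantQuadruples d s))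
    (hA2 : ¬ ∃ x ∈ φ, x.1 ∈ cube s 0 \ cube (s - s ^ (-(d : ℤ))) 0)
    (hf : ¬ ∃ x ∈ φ, x.1 ∈ {ξ ∈ cube (3 * s) (0 : Space d) |
      Metric.infDist ξ (frontier (cube s 0)) < s ^ (-(2 * d : ℤ))})
    (ha : ¬ HasTuple φ (annulusPairs d s (s ^ (-(2 * d : ℤ)))))
    (hA4 : ¬ ∃ p ∈ slabIndices d, ∃ x ∈ φ, x.1 ∈ obliqueSlab d s p) :
    φ ∩ marked K (cube (3 * s) 0) ∈ goodEvent d K s := by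
  simp only [not_exists, not_lt] at h1
  refine ⟨⟨⟨inter_mem_A1 hφ hs h1 h3 h4, inter_mem_A2 hφ hA2 _⟩, inter_mem_A3 hφ hf ha⟩,
    inter_mem_A4 hφ (fun p hp h => hA4 ⟨p, hp, h⟩) _⟩

lemma tendsto_measure_not_goodEvent [IsProbabilityMeasure P] (hd : 1 ≤ d)
    (hX : ∀ s : ℝ, 1 < s → IsIndepMarkedPoisson P (1 - s ^ (-((d : ℤ) + 1))) π (X s)) :
    Tendsto (fun s : ℝ => P {ω | X s ω ∩ marked K (cube (3 * s) 0) ∈ goodEvent d K s}ᶜ)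
      atTop (𝓝 0) := by
  have hγ : ∀ s : ℝ, 1 < s → 1 - s ^ (-((d : ℤ) + 1)) ≤ 1 := fun s hs => by
    have : 0 ≤ s ^ (-((d : ℤ) + 1)) := by positivity
    linarith
  have l1 := tendsto_measure_count_subcube hd hX
  have l3 : Tendsto (fun s => P {ω | HasTuple (X s ω) (isoscelesTriples d s)}) atTop (𝓝 0) :=
    -- The constant is `0` because the event is null for every `s > 1`.
    tendsto_zero_of_le_ofReal_mul_inv 0 fun s hs =>
      ((hX s hs).measure_hasTuple_le (hγ s hs) hd (isCompact_isoscelesTriples (by positivity))).trans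
        (by rw [volume_isoscelesTriples hd (by positivity)]; exact zero_le)
  have l4 : Tendsto (fun s => P {ω | HasTuple (X s ω) (equidistantQuadruples d s)}) atTop (𝓝 0) :=
    tendsto_zero_of_le_ofReal_mul_inv 0 fun s hs =>
      ((hX s hs).measure_hasTuple_le (hγ s hs) hd
        (isCompact_equidistantQuadruples (by positivity))).trans
        (by rw [volume_equidistantQuadruples hd (by positivity)]; exact zero_le)
  have lA2 := tendsto_zero_of_le_ofReal_mul_inv _ fun s hs =>
    (hX s hs).measure_not_A2_le (hγ s hs) hd hs
  have lf := tendsto_zero_of_le_ofReal_mul_inv _ fun s hs =>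
    (hX s hs).measure_near_frontier_le (hγ s hs) hd hs
  have la := tendsto_zero_of_le_ofReal_mul_inv _ fun s hs =>
    (hX s hs).measure_annulusPairs_le (hγ s hs) hd hs
  have lA4 := tendsto_zero_of_le_ofReal_mul_inv _ fun s hs =>
    (hX s hs).measure_not_A4_le (hγ s hs) hd hs
  have hsum := (((((l1.add l3).add l4).add lA2).add lf).add la).add lA4
  simp only [add_zero] at hsum
  refine tendsto_of_tendsto_of_tendsto_of_le_of_le' tendsto_const_nhds hsum
    (Eventually.of_forall fun _ => zero_le) ?_
  filter_upwards [eventually_gt_atTop 1] with s hs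
  refine le_trans (measure_mono fun ω hω => ?_)
    ((measure_union_le _ _).trans (add_le_add_left ((measure_union_le _ _).trans
      (add_le_add_left ((measure_union_le _ _).trans (add_le_add_left
        ((measure_union_le _ _).trans (add_le_add_left ((measure_union_le _ _).trans
          (add_le_add_left (measure_union_le _ _) _)) _)) _)) _)) _))
  by_contra hcon
  simp only [Set.mem_union, not_or, Set.mem_ofPred_eq] at hcon
  obtain ⟨⟨⟨⟨⟨⟨h1, h3⟩, h4⟩, hA2⟩, hf⟩, ha⟩, hA4⟩ := hcon
  exact hω (inter_mem_goodEvent ((hX s hs).locFin ω) (by positivity) h1 h3 h4 hA2 hf ha hA4)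

end Limit

end KNNWalk

theorem mainTheorem3 (d K : ℕ) (hd : 1 ≤ d) (hK : 1 ≤ K)
    (π : Measure (KNNWalk.Mark K)) [IsProbabilityMeasure π]
    {Ω : Type*} [MeasurableSpace Ω] (P : Measure Ω) [IsProbabilityMeasure P]
    (X₁ : ℝ → Ω → KNNWalk.Config d K)
    (hX₁ : ∀ s : ℝ, 1 < s →
      KNNWalk.IsIndepMarkedPoisson P (1 - s ^ (-((d : ℤ) + 1))) π (X₁ s)) :
    Tendsto
      (fun s : ℝ =>
        P {ω | X₁ s ω ∩ KNNWalk.marked K (KNNWalk.cube (3 * s) 0) ∈ KNNWalk.goodEvent d K s})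
      atTop (𝓝 1) := by
  have h := ENNReal.Tendsto.sub (tendsto_const_nhds (x := (1 : ENNReal)))
    (KNNWalk.tendsto_measure_not_goodEvent hd hX₁) (Or.inl ENNReal.one_ne_top)
  rw [tsub_zero] at h
  refine tendsto_of_tendsto_of_tendsto_of_le_of_le h tendsto_const_nhds (fun s => ?_)
    fun s => prob_le_one
  -- Subadditivity alone gives `1 - P(bad) ≤ P(good)`, so measurability of the good event is not
  -- required.
  rw [tsub_le_iff_right, ← measure_univ (μ := P), ← Set.union_compl_self]
  exact measure_union_le _ _
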